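/- Let $q$ be a prime power and let $n,k,d,r,\delta,m,u$ be integers with $r\ge 1$, $\delta\ge 1$. An $[n,k,d]_q$ linear code $\mathcal C$ is a $k$-dimensional subspace of $\mathbb F_q^n$ with minimum Hamming distance $d$. For a set $S$ of coordinates, $\mathcal C|_S$ denotes the punctured code obtained from $\mathcal C$ by deleting the symbols outside $S$. The $j$-th code symbol has $(r,\delta)$-locality if there is a set $S_j$ of coordinates with $j\in S_j$, $|S_j|\le r+\delta-1$, such that $\mathcal C|_{S_j}$ has minimum Hamming distance at least $\delta$ (the zero code is taken to have minimum distance $\infty$). The code has information $(r,\delta)$-locality if all symbols in some set $S$ of coordinates with $\dim \mathcal C|_S=k$ have $(r,\delta)$-locality, and all-symbol $(r,\delta)$-locality if all its symbols have $(r,\delta)$-locality. A code with information $(r,\delta)$-locality (in particular, one with all-symbol $(r,\delta)$-locality) is an optimal locally repairable code (LRC) if $$d=n-k+1-\left(\left\lceil\frac kr\right\rceil-1\right)(\delta-1).$$ For real $x$, let $\psi(x)$ be the smallest prime power that is greater than or equal to $x$. **Theorem.** Let $\mathcal C$ be an optimal $[n,k,d]_q$ LRC with all-symbol $(r,\delta)$-locality,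 where $n=m(r+\delta-1)$, $k=ur$ and $u\ge 2$. 1. If $r$ is even and $m\ge u+1$, then $$q\ \ge\ \psi\left(\left(\left(\frac kr+1\right)\left\lfloor\frac{2r+2\delta-2}{r}\right\rfloor-1\right)^{2/r}\right).$$ 2. If $r$ is odd and $m\ge u+2$, then $$q\ \ge\ \psi\left(\left(\frac kr\right)^{2/(r+1)}\right).$$ -/

import Mathlib

/-- The minimum Hamming distance of a linear code of length `|ι|` over `F`, i.e. the least Hamming
distance between two distinct codewords. The zero code, which has no two distinct codewords, gets
the value `⊤`. -/
noncomputable def minDist {F ι : Type*} [Field F] [DecidableEq F] [Fintype ι]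
    (C : Submodule F (ι → F)) : ℕ∞ :=
  ⨅ x ∈ C, ⨅ y ∈ C, ⨅ _ : x ≠ y, (hammingDist x y : ℕ∞)

/-- `C` is an `[n, k, d]` linear code over `F`: a `k`-dimensional subspace of `F ^ n` with minimum
Hamming distance `d`. -/
def IsLinearCode {F : Type*} [Field F] [DecidableEq F] {n : ℕ}
    (C : Submodule F (Fin n → F)) (k d : ℕ) : Prop :=
  Module.finrank F C = k ∧ minDist C = d

/-- The punctured code `C|_S`: all code symbols at positions outside `S` are deleted. -/
def puncture {F : Type*} [Field F] {n : ℕ}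
    (C : Submodule F (Fin n → F)) (S : Finset (Fin n)) : Submodule F (S → F) :=
  C.map (LinearMap.funLeft F F (fun j : S => (j : Fin n)))

/-- `S` is a repair set, with respect to `(r, δ)`-locality, of the `j`-th code symbol of `C`. -/
def IsRepairSet {F : Type*} [Field F] [DecidableEq F] {n : ℕ}
    (C : Submodule F (Fin n → F)) (r δ : ℕ) (j : Fin n) (S : Finset (Fin n)) : Prop :=
  j ∈ S ∧ S.card ≤ r + δ - 1 ∧ (δ : ℕ∞) ≤ minDist (puncture C S)

/-- The `j`-th code symbol of `C` has `(r, δ)`-locality. -/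
def SymbolHasLocality {F : Type*} [Field F] [DecidableEq F] {n : ℕ}
    (C : Submodule F (Fin n → F)) (r δ : ℕ) (j : Fin n) : Prop :=
  ∃ S : Finset (Fin n), IsRepairSet C r δ j S

/-- `C` has information `(r, δ)`-locality: the symbols in some set `S` of full rank have
`(r, δ)`-locality. The rank of a set `S` of coordinates is the rank of the columns indexed by `S`
of a generator matrix of `C`, which is the dimension of the punctured code `C|_S`. -/
def HasInformationLocality {F : Type*} [Field F] [DecidableEq F] {n : ℕ}
    (C : Submodule F (Fin n → F)) (r δ : ℕ) : Prop :=
  ∃ S : Finset (Fin n), Module.finrank F (puncture C S) = Module.finrank F C ∧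
    ∀ j ∈ S, SymbolHasLocality C r δ j

/-- `C` has all-symbol `(r, δ)`-locality. -/
def HasAllSymbolLocality {F : Type*} [Field F] [DecidableEq F] {n : ℕ}
    (C : Submodule F (Fin n → F)) (r δ : ℕ) : Prop :=
  ∀ j : Fin n, SymbolHasLocality C r δ j

/-- `C` is an optimal `[n, k, d]` locally repairable code: it has information `(r, δ)`-locality and
its minimum distance attains the Singleton-type bound
`d ≤ n - k + 1 - (⌈k / r⌉ - 1) (δ - 1)` with equality. -/
def IsOptimalLRC {F : Type*} [Field F] [DecidableEq F] {n : ℕ}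
    (C : Submodule F (Fin n → F)) (k d r δ : ℕ) : Prop :=
  IsLinearCode C k d ∧ HasInformationLocality C r δ ∧
    (d : ℤ) = (n : ℤ) - k + 1 - (⌈(k : ℝ) / r⌉ - 1) * ((δ : ℤ) - 1)

/-- `leastPrimePower x` is the least prime power `p ^ a`, with `p` prime and `a ≥ 1`, that is
greater than or equal to `x`. -/
noncomputable def leastPrimePower (x : ℝ) : ℕ :=
  sInf {p : ℕ | IsPrimePow p ∧ x ≤ p}

theorem leastPrimePower_isLeast (x : ℝ) :
    IsLeast {p : ℕ | IsPrimePow p ∧ x ≤ p} (leastPrimePower x) := by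
  have hne : {p : ℕ | IsPrimePow p ∧ x ≤ p}.Nonempty := by
    obtain ⟨p, hp, hprime⟩ := Nat.exists_infinite_primes ⌈x⌉₊
    exact ⟨p, hprime.isPrimePow, (Nat.le_ceil x).trans (by exact_mod_cast hp)⟩
  exact ⟨Nat.sInf_mem hne, fun _ hp => Nat.sInf_le hp⟩

/-!
Write `K(A)` for the space of codewords that vanish on a set `A` of coordinates, and `corank C A`
for its dimension. As `C` attains the Singleton-type bound, `|A| + corank C A` is at most
`u r + (u - 1) (δ - 1)` whenever `K(A)` is nonzero (`card_add_corank_le`).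

*Local groups.* Let `A` grow by one repair set at a time, where each of them lowers the corank.
Every step lowers the corank by at most `r` and adds at least `δ - 1` more coordinates than it
costs dimensions. For `δ ≥ 2` the bound above then allows only `u` steps before the corank is
`0`, so every step costs exactly `r` dimensions, and its set has `r + δ - 1` coordinates and is
disjoint from `A` (`IsChainUnion.corank_add_eq`, `IsChainUnion.card_sdiff_eq`). Moreover a union of
fewer than `u` steps is a flat (`IsChainUnion.mem_of_forall_eq_zero`). As `u ≥ 2`, two repair sets
are therefore equal or disjoint, and the coordinates split into `m` groups of size `r + δ - 1` and
rank `r` (`exists_local_groups`).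

*Counting.* Keep `M = u + 1` groups if `r` is even and `M = u + 2` if `r` is odd, and let `L` be
the direct sum of the codes on these groups, of dimension `M r`. The truncation of `C` to the groups
is a subspace of `L` of codimension `(M - u) r`, and its nonzero words have weight greater than
`(M - u) r + (M - u + 1) (δ - 1)`. In a group, the words supported on `a + δ - 1` coordinates form
a subspace of dimension at least `a`.
* For even `r = 2 a` each group contains `⌊(r + δ - 1) / a⌋` such subspaces, which vanish on
  disjoint sets of size `a`. By the weight bound, the subspaces from all the groups are embedded in
  the quotient of dimension `2 a` and meet pairwise trivially there, so there are at most `q ^ a + 1`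
  of them (`card_le_of_partial_spread`, `IsGroupFamily.mul_le_of_even`).
* For odd `r = 2 a - 1`, the quotient by a further subspace of dimension `r - 1`, taken from one of
  the groups, has dimension at most `2 a`, and each of the other `u + 1` groups contributes one
  subspace (`IsGroupFamily.le_of_odd`).
-/

open Module

/-! ### Codewords vanishing on a set of coordinates -/

section Vanishing

variable {F ι : Type*} [Field F]

/-- The vectors that vanish at all coordinates in `A`. -/
def vanishOn (F : Type*) {ι : Type*} [Field F] (A : Finset ι) : Submodule F (ι → F) where
  carrier := {x | ∀ j ∈ A, x j = 0}
  add_mem' hx hy j hj := by simp [hx j hj, hy j hj]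
  zero_mem' _ _ := rfl
  smul_mem' a x hx j hj := by simp [hx j hj]

theorem mem_vanishOn {A : Finset ι} {x : ι → F} : x ∈ vanishOn F A ↔ ∀ j ∈ A, x j = 0 := Iff.rfl

/-- The number `dim C - rank A`: the dimension of the space of codewords vanishing on `A`. -/
noncomputable def corank (C : Submodule F (ι → F)) (A : Finset ι) : ℕ :=
  finrank F (C ⊓ vanishOn F A : Submodule F (ι → F))

theorem corank_empty (C : Submodule F (ι → F)) : corank C ∅ = finrank F C := by
  have : vanishOn F (∅ : Finset ι) = ⊤ := by
    ext x; simp [mem_vanishOn]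
  rw [corank, this, inf_top_eq]

theorem finrank_le_finrank_inf_vanishOn_add [Fintype ι] (N : Submodule F (ι → F)) (D : Finset ι) :
    finrank F N ≤ finrank F (N ⊓ vanishOn F D : Submodule F (ι → F)) + D.card := by
  let g : N →ₗ[F] (D → F) := (LinearMap.funLeft F F (fun j : D => (j : ι))).comp N.subtype
  have h := g.finrank_range_add_finrank_ker
  have h1 : finrank F (LinearMap.range g) ≤ D.card := by
    simpa using Submodule.finrank_le (LinearMap.range g)
  have h2 : finrank F (LinearMap.ker g) =
      finrank F (N ⊓ vanishOn F D : Submodule F (ι → F)) := by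
    have hker : LinearMap.ker g = (N ⊓ vanishOn F D).comap N.subtype := by
      ext x
      simp only [LinearMap.mem_ker, funext_iff, Submodule.mem_comap, Submodule.mem_inf]
      exact ⟨fun h => ⟨x.2, fun j hj => h ⟨j, hj⟩⟩, fun h j => h.2 j j.2⟩
    rw [hker]
    exact (Submodule.comapSubtypeEquivOfLe inf_le_left).finrank_eq
  omega

theorem exists_mem_ne_zero_of_corank_pos {C : Submodule F (ι → F)} {A : Finset ι}
    (h : 0 < corank C A) : ∃ c ∈ C, (∀ j ∈ A, c j = 0) ∧ ∃ i, c i ≠ 0 := by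
  obtain ⟨c, hc, h0⟩ := Submodule.exists_mem_ne_zero_of_ne_bot (p := C ⊓ vanishOn F A)
    (by intro hb; rw [corank, hb, finrank_bot] at h; exact h.ne rfl)
  exact ⟨c, hc.1, hc.2, Function.ne_iff.1 h0⟩

theorem corank_congr {C : Submodule F (ι → F)} {A B : Finset ι}
    (h : ∀ c ∈ C, (∀ j ∈ A, c j = 0) ↔ ∀ j ∈ B, c j = 0) : corank C A = corank C B := by
  have : C ⊓ vanishOn F A = C ⊓ vanishOn F B := by
    ext c
    exact ⟨fun hc => ⟨hc.1, (h c hc.1).1 hc.2⟩, fun hc => ⟨hc.1, (h c hc.1).2 hc.2⟩⟩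
  rw [corank, corank, this]

variable [DecidableEq ι]

theorem vanishOn_union (A B : Finset ι) :
    vanishOn F (A ∪ B) = vanishOn F A ⊓ vanishOn F B := by
  ext x
  simp only [mem_vanishOn, Submodule.mem_inf, Finset.mem_union]
  exact ⟨fun h => ⟨fun j hj => h j (Or.inl hj), fun j hj => h j (Or.inr hj)⟩,
    fun h j hj => hj.elim (h.1 j) (h.2 j)⟩

theorem corank_le_corank_union_add [Fintype ι] (C : Submodule F (ι → F)) (A B : Finset ι) :
    corank C A ≤ corank C (A ∪ B) + (B \ A).card := by
  have h := finrank_le_finrank_inf_vanishOn_add (C ⊓ vanishOn F A) (B \ A)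
  rwa [inf_assoc, ← vanishOn_union, Finset.union_sdiff_self_eq_union] at h

theorem corank_union_lt [Fintype ι] {C : Submodule F (ι → F)} {A S : Finset ι} {c : ι → F} {i : ι}
    (hc : c ∈ C) (hA : ∀ j ∈ A, c j = 0) (hi : i ∈ S) (hci : c i ≠ 0) :
    corank C (A ∪ S) < corank C A := by
  refine Submodule.finrank_lt_finrank_of_lt (lt_of_le_of_ne ?_ ?_)
  · rw [vanishOn_union]; exact inf_le_inf_left _ inf_le_left
  · intro h
    have : c ∈ C ⊓ vanishOn F (A ∪ S) := h ▸ ⟨hc, hA⟩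
    exact hci (this.2 i (Finset.mem_union_right _ hi))

variable [DecidableEq F]

/-- The Singleton bound for the subcode of codewords vanishing on `A`. -/
theorem card_add_corank_le [Fintype ι] {C : Submodule F (ι → F)} {d : ℕ} (hd1 : 1 ≤ d)
    (hd : ∀ c ∈ C, c ≠ 0 → d ≤ hammingNorm c) {A : Finset ι} (h : 0 < corank C A) :
    A.card + corank C A + d ≤ Fintype.card ι + 1 := by
  have key : ∀ B : Finset ι, 0 < corank C B → B.card + d ≤ Fintype.card ι := by
    intro B hB
    obtain ⟨c, hc, hv, i, hi⟩ := exists_mem_ne_zero_of_corank_pos hB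
    have h1 := hd c hc (fun h => hi (by simp [h]))
    have h2 : hammingNorm c ≤ (Bᶜ).card := Finset.card_le_card fun j hj => by
      simp only [Finset.mem_filter, Finset.mem_compl] at hj ⊢
      exact fun hjB => hj.2 (hv j hjB)
    rw [Finset.card_compl] at h2
    have := B.card_le_univ
    omega
  have hA := key A h
  obtain ⟨E, hE, hEc⟩ := Finset.exists_subset_card_eq (s := Aᶜ)
    (n := Fintype.card ι + 1 - d - A.card) (by
      rw [Finset.card_compl]
      omega)
  have hdis : Disjoint A E := Finset.disjoint_left.2 fun j hj hjE => Finset.mem_compl.1 (hE hjE) hj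
  have h0 : corank C (A ∪ E) = 0 := by
    by_contra hne
    have := key _ (Nat.pos_of_ne_zero hne)
    rw [Finset.card_union_of_disjoint hdis] at this
    omega
  have := corank_le_corank_union_add C A E
  rw [Finset.sdiff_eq_self_of_disjoint hdis.symm] at this
  omega

end Vanishing

/-! ### The structure of the local groups -/

section Structure

variable {F ι : Type*} [Field F] [DecidableEq F]

/-- A set `S` of at most `r + δ - 1` coordinates such that the restriction to `S` of every codeword
is zero or has weight at least `δ`. -/
structure IsLocalSet (C : Submodule F (ι → F)) (r δ : ℕ) (S : Finset ι) : Prop where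
  card_le : S.card ≤ r + δ - 1
  le_weight : ∀ c ∈ C, (∃ j ∈ S, c j ≠ 0) → δ ≤ (S.filter fun j => c j ≠ 0).card

variable {C : Submodule F (ι → F)} {r δ : ℕ} {S : Finset ι}

theorem IsLocalSet.mono (hS : IsLocalSet C r δ S) {C' : Submodule F (ι → F)} (h : C' ≤ C) :
    IsLocalSet C' r δ S :=
  ⟨hS.card_le, fun c hc => hS.le_weight c (h hc)⟩

variable [DecidableEq ι]

theorem IsLocalSet.vanish (hS : IsLocalSet C r δ S) {E : Finset ι} (hE : E.card < δ)
    {c : ι → F} (hc : c ∈ C) (h0 : ∀ j ∈ S \ E, c j = 0) : ∀ j ∈ S, c j = 0 := by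
  by_contra! hne
  have h1 := hS.le_weight c hc hne
  have h2 : (S.filter fun j => c j ≠ 0) ⊆ E := fun j hj => by
    rw [Finset.mem_filter] at hj
    by_contra hjE
    exact hj.2 (h0 j (Finset.mem_sdiff.2 ⟨hj.1, hjE⟩))
  have := Finset.card_le_card h2
  omega

theorem IsLocalSet.erase (hS : IsLocalSet C r δ S) {x : ι} (hx : ∀ c ∈ C, c x = 0) :
    IsLocalSet C r δ (S.erase x) := by
  refine ⟨(Finset.card_erase_le).trans hS.card_le, ?_⟩
  rintro c hc ⟨j, hj, hj0⟩
  have h := hS.le_weight c hc ⟨j, Finset.mem_of_mem_erase hj, hj0⟩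
  rwa [Finset.filter_erase, Finset.erase_eq_of_notMem]
  simp [hx c hc]

variable {u t : ℕ} {A : Finset ι}

/-- The numerical properties of a union `A` of `t` local sets in which each local set lowers the
corank of the union of the preceding ones: each of them costs at most `r` dimensions and is
larger by `δ - 1` than the number of dimensions that it costs. -/
structure IsChainUnion (C : Submodule F (ι → F)) (u r δ t : ℕ) (A : Finset ι) : Prop where
  le_card_add : u * r + t * (δ - 1) ≤ A.card + corank C A
  le_corank_add : u * r ≤ corank C A + t * r

omit [DecidableEq F] [DecidableEq ι] in
theorem isChainUnion_empty (hk : finrank F C = u * r) : IsChainUnion C u r δ 0 ∅ := by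
  constructor <;> simp [corank_empty, hk]

/-- Inside a local set, any `δ - 1` coordinates are determined by the remaining ones. Leaving out
`δ - 1` of the new coordinates therefore does not change the corank of the union. -/
theorem corank_add_le_of_isLocalSet [Fintype ι] (hS : IsLocalSet (C ⊓ vanishOn F A) r δ S)
    (hδ : 1 ≤ δ) (hlt : corank C (A ∪ S) < corank C A) :
    corank C A + (δ - 1) ≤ corank C (A ∪ S) + (S \ A).card := by
  have aux : ∀ E : Finset ι, E.card < δ → corank C (A ∪ (S \ E)) = corank C (A ∪ S) := by
    intro E hE
    refine corank_congr fun c hc => ?_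
    simp only [Finset.mem_union, or_imp, forall_and]
    exact ⟨fun h => ⟨h.1, hS.vanish hE ⟨hc, h.1⟩ h.2⟩,
      fun h => ⟨h.1, fun j hj => h.2 j (Finset.mem_sdiff.1 hj).1⟩⟩
  have hcard : δ ≤ (S \ A).card := by
    by_contra! h
    have h1 := aux _ h
    rw [sdiff_sdiff_right_self, Finset.inf_eq_inter,
      Finset.union_eq_left.2 Finset.inter_subset_right] at h1
    omega
  obtain ⟨E, hE, hEc⟩ := Finset.exists_subset_card_eq (s := S \ A) (n := δ - 1) (by omega)
  have h1 := aux E (by omega)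
  have h2 := corank_le_corank_union_add C A (S \ E)
  have h3 : (S \ E) \ A = (S \ A) \ E := sdiff_right_comm _ _ _
  rw [h1, h3, Finset.card_sdiff_of_subset hE] at h2
  have := Finset.card_le_card hE
  omega

theorem IsChainUnion.step [Fintype ι] (hA : IsChainUnion C u r δ t A)
    (hS : IsLocalSet (C ⊓ vanishOn F A) r δ S)
    (hδ : 1 ≤ δ) (hlt : corank C (A ∪ S) < corank C A) : IsChainUnion C u r δ (t + 1) (A ∪ S) := by
  have h1 := corank_add_le_of_isLocalSet hS hδ hlt
  have h2 : (A ∪ S).card = A.card + (S \ A).card := by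
    rw [← Finset.union_sdiff_self_eq_union, Finset.card_union_of_disjoint Finset.disjoint_sdiff]
  have h3 : (S \ A).card ≤ S.card := Finset.card_le_card Finset.sdiff_subset
  have h4 := hS.card_le
  have h5 := hA.le_card_add
  have h6 := hA.le_corank_add
  constructor
  · rw [add_mul]; omega
  · rw [add_mul]; omega

section Optimal

variable [Fintype ι] (hk : finrank F C = u * r) (hr : 1 ≤ r) (hδ : 2 ≤ δ)
  (hB : ∀ A : Finset ι, 0 < corank C A → A.card + corank C A ≤ u * r + (u - 1) * (δ - 1))
  (hcov : ∀ j, ∃ S, j ∈ S ∧ IsLocalSet C r δ S)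

include hr hδ hB hcov

/-- In an optimal code every step of a chain costs exactly `r` dimensions: a chain can be continued
until the corank is `0`, and by optimality this happens after at most `u` steps. -/
theorem IsChainUnion.corank_add_eq (hA : IsChainUnion C u r δ t A) (hu : 1 ≤ u) (ht : t ≤ u) :
    corank C A + t * r = u * r := by
  induction hs : u - t generalizing t A with
  | zero =>
    obtain rfl : t = u := by omega
    have h1 := hA.le_card_add
    rcases Nat.eq_zero_or_pos (corank C A) with h | h
    · rw [h, zero_add]
    have h2 := hB A h
    obtain ⟨v, rfl⟩ : ∃ v, t = v + 1 := ⟨t - 1, by omega⟩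
    rw [add_mul v 1 (δ - 1)] at h1
    rw [Nat.add_sub_cancel] at h2
    omega
  | succ s ih =>
    have h1 := hA.le_corank_add
    have h2 : t * r + r ≤ u * r := by
      rw [← Nat.succ_mul]; exact Nat.mul_le_mul_right _ (by omega)
    obtain ⟨c, hc, hcA, i, hi⟩ := exists_mem_ne_zero_of_corank_pos (C := C) (A := A) (by omega)
    obtain ⟨S, hiS, hS⟩ := hcov i
    have hlt := corank_union_lt hc hcA hiS hi
    have hS' := hS.mono (inf_le_left : C ⊓ vanishOn F A ≤ C)
    have h3 := ih (hA.step hS' (by omega) hlt) (by omega) (by omega)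
    have h4 := corank_add_le_of_isLocalSet hS' (by omega) hlt
    have h5 : (S \ A).card ≤ S.card := Finset.card_le_card Finset.sdiff_subset
    have h6 := hS.card_le
    rw [add_mul] at h3
    omega

theorem IsChainUnion.card_sdiff_eq (hA : IsChainUnion C u r δ t A) (ht : t + 1 ≤ u)
    (hS : IsLocalSet (C ⊓ vanishOn F A) r δ S) (hlt : corank C (A ∪ S) < corank C A) :
    S.card = r + δ - 1 ∧ Disjoint A S := by
  have h1 := hA.corank_add_eq hr hδ hB hcov (by omega) (by omega)
  have h2 := (hA.step hS (by omega) hlt).corank_add_eq hr hδ hB hcov (by omega) ht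
  have h3 := corank_add_le_of_isLocalSet hS (by omega) hlt
  have h4 := hS.card_le
  have h5 := Finset.card_sdiff_add_card_inter S A
  rw [add_mul] at h2
  refine ⟨by omega, ?_⟩
  rw [Finset.disjoint_iff_inter_eq_empty, Finset.inter_comm, ← Finset.card_eq_zero]
  omega

/-- The union of fewer than `u` steps of a chain is a flat. Otherwise the chain could be continued
to `u - 1` steps by local sets without a coordinate `x` of the closure, and adding `x` at
the end would violate the Singleton bound. -/
theorem IsChainUnion.mem_of_forall_eq_zero (hA : IsChainUnion C u r δ t A) (ht : t + 1 ≤ u) {x : ι}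
    (hx : ∀ c ∈ C ⊓ vanishOn F A, c x = 0) : x ∈ A := by
  induction hs : u - (t + 1) generalizing t A with
  | zero =>
    obtain rfl : u = t + 1 := by omega
    have h1 := hA.corank_add_eq hr hδ hB hcov (by omega) (by omega)
    have h2 := hA.le_card_add
    have h3 : corank C (insert x A) = corank C A := corank_congr fun c hc => by
      simp only [Finset.mem_insert, forall_eq_or_imp]
      exact ⟨fun h => h.2, fun h => ⟨hx c ⟨hc, h⟩, h⟩⟩
    have h4 := hB (insert x A)
    by_contra hxA
    rw [Finset.card_insert_of_notMem hxA, h3] at h4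
    rw [add_mul] at h1
    have := h4 (by omega)
    rw [Nat.add_sub_cancel] at this
    omega
  | succ s ih =>
    have h1 := hA.corank_add_eq hr hδ hB hcov (by omega) (by omega)
    have h2 : t * r + r ≤ u * r := by
      rw [← Nat.succ_mul]; exact Nat.mul_le_mul_right _ (by omega)
    obtain ⟨c, hc, hcA, i, hi⟩ := exists_mem_ne_zero_of_corank_pos (C := C) (A := A) (by omega)
    obtain ⟨S, hiS, hS⟩ := hcov i
    have hix : i ≠ x := by rintro rfl; exact hi (hx c ⟨hc, hcA⟩)
    have hS' := (hS.mono (inf_le_left : C ⊓ vanishOn F A ≤ C)).erase hx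
    have hlt := corank_union_lt hc hcA (Finset.mem_erase.2 ⟨hix, hiS⟩) hi
    have h3 := ih (hA.step hS' (by omega) hlt) (by omega) (fun c hc => hx c
      ⟨hc.1, fun j hj => hc.2 j (Finset.mem_union_left _ hj)⟩) (by omega)
    simpa using h3

include hk

theorem corank_empty_union_lt (hu : 2 ≤ u) (hne : S.Nonempty) :
    corank C (∅ ∪ S) < corank C ∅ := by
  obtain ⟨j, hj⟩ := hne
  have := mt ((isChainUnion_empty hk).mem_of_forall_eq_zero hr hδ hB hcov (by omega) (x := j))
    (Finset.notMem_empty j)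
  push Not at this
  obtain ⟨c, hc, hcj⟩ := this
  exact corank_union_lt hc.1 hc.2 hj hcj

theorem card_and_corank_of_isLocalSet (hu : 2 ≤ u) (hS : IsLocalSet C r δ S) (hne : S.Nonempty) :
    S.card = r + δ - 1 ∧ IsChainUnion C u r δ 1 S ∧ corank C S + r = u * r := by
  have hlt := corank_empty_union_lt hk hr hδ hB hcov hu hne
  have h0 := isChainUnion_empty (δ := δ) hk
  have hS' := hS.mono (inf_le_left : C ⊓ vanishOn F ∅ ≤ C)
  have h1 := h0.step hS' (by omega) hlt
  have h2 := (h0.card_sdiff_eq hr hδ hB hcov (by omega) hS' hlt).1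
  rw [Finset.empty_union] at h1
  have := h1.corank_add_eq hr hδ hB hcov (by omega) (by omega)
  rw [zero_add, one_mul] at this
  exact ⟨h2, h1, this⟩

theorem eq_or_disjoint_of_isLocalSet (hu : 2 ≤ u) {S' : Finset ι} (hS : IsLocalSet C r δ S)
    (hne : S.Nonempty) (hS' : IsLocalSet C r δ S') (hne' : S'.Nonempty) :
    S = S' ∨ Disjoint S S' := by
  obtain ⟨h1, h2, h3⟩ := card_and_corank_of_isLocalSet hk hr hδ hB hcov hu hS hne
  obtain ⟨h1', -, -⟩ := card_and_corank_of_isLocalSet hk hr hδ hB hcov hu hS' hne'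
  by_cases hx : ∀ x ∈ S', ∀ c ∈ C ⊓ vanishOn F S, c x = 0
  · left
    -- `S'` lies in the closure of `S`, which is `S` itself
    have hsub : S' ⊆ S := fun x hxS' =>
      h2.mem_of_forall_eq_zero hr hδ hB hcov (by omega) (hx x hxS')
    exact (Finset.eq_of_subset_of_card_le hsub (by omega)).symm
  · right
    push Not at hx
    obtain ⟨x, hxS', c, hc, hcx⟩ := hx
    exact (h2.card_sdiff_eq hr hδ hB hcov (by omega) (hS'.mono inf_le_left)
      (corank_union_lt hc.1 hc.2 hxS' hcx)).2

end Optimal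

omit [DecidableEq ι] in
theorem exists_pairwise_disjoint_subsets (T : Finset ι) {f s : ℕ} (h : f * s ≤ T.card) :
    ∃ D : Fin f → Finset ι, (∀ i, D i ⊆ T) ∧ (∀ i, (D i).card = s) ∧
      Pairwise fun i j => Disjoint (D i) (D j) := by
  let e : Fin f × Fin s ↪ ι := (finProdFinEquiv.toEmbedding.trans (Fin.castLEEmb h)).trans
    (T.equivFin.symm.toEmbedding.trans (Function.Embedding.subtype _))
  refine ⟨fun i => Finset.univ.map ((Function.Embedding.sectR i (Fin s)).trans e), fun i => ?_,
    fun i => by simp, fun i j hij => ?_⟩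
  · intro x hx
    obtain ⟨y, -, rfl⟩ := Finset.mem_map.1 hx
    exact (T.equivFin.symm _).2
  · refine Finset.disjoint_left.2 fun x hx hx' => ?_
    obtain ⟨y, -, rfl⟩ := Finset.mem_map.1 hx
    obtain ⟨z, -, h⟩ := Finset.mem_map.1 hx'
    exact hij (congrArg Prod.fst (e.injective h)).symm

/-- The coordinates of an optimal code split into `m` local groups of the maximal size `r + δ - 1`
and rank `r`. For `δ = 1` locality is no condition, and any partition into sets of size `r` will
do. -/
theorem exists_local_groups [Fintype ι] {m : ℕ} (hk : finrank F C = u * r) (hr : 1 ≤ r)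
    (hδ : 1 ≤ δ) (hu : 2 ≤ u)
    (hB : ∀ A : Finset ι, 0 < corank C A → A.card + corank C A ≤ u * r + (u - 1) * (δ - 1))
    (hcov : ∀ j, ∃ S, j ∈ S ∧ IsLocalSet C r δ S) (hn : Fintype.card ι = m * (r + δ - 1)) :
    ∃ T : Fin m → Finset ι, (Pairwise fun i j => Disjoint (T i) (T j)) ∧
      ∀ i, (T i).card = r + δ - 1 ∧ IsLocalSet C r δ (T i) ∧ corank C (T i) + r = u * r := by
  have hur : 2 * r ≤ u * r := Nat.mul_le_mul_right _ hu
  rcases hδ.eq_or_lt with rfl | hδ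
  · obtain ⟨T, -, hT, hdis⟩ := exists_pairwise_disjoint_subsets (Finset.univ : Finset ι)
      (f := m) (s := r) (by rw [Finset.card_univ, hn, Nat.add_sub_cancel])
    refine ⟨T, hdis, fun i => ⟨by simp [hT], ⟨by simp [hT], ?_⟩, ?_⟩⟩
    · rintro c - ⟨j, hj, hj0⟩
      exact Finset.card_pos.2 ⟨j, Finset.mem_filter.2 ⟨hj, hj0⟩⟩
    · have h1 := corank_le_corank_union_add C ∅ (T i)
      rw [corank_empty, hk, Finset.empty_union, Finset.sdiff_empty, hT] at h1
      have h2 := hB (T i) (by omega)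
      rw [hT] at h2
      omega
  · choose S hjS hS using hcov
    have hcov : ∀ j, ∃ S, j ∈ S ∧ IsLocalSet C r δ S := fun j => ⟨S j, hjS j, hS j⟩
    have hprop := fun j => card_and_corank_of_isLocalSet hk hr hδ hB hcov hu (hS j) ⟨j, hjS j⟩
    let P : Finset (Finset ι) := Finset.univ.image S
    have hP : ∀ X ∈ P, ∃ j, S j = X := fun X hX => by simpa [P] using hX
    have hdis : ∀ X ∈ P, ∀ Y ∈ P, X ≠ Y → Disjoint X Y := by
      intro X hX Y hY hXY
      obtain ⟨i, rfl⟩ := hP X hX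
      obtain ⟨j, rfl⟩ := hP Y hY
      exact (eq_or_disjoint_of_isLocalSet hk hr hδ hB hcov hu (hS i) ⟨i, hjS i⟩ (hS j)
        ⟨j, hjS j⟩).resolve_left hXY
    have hPc : P.card = m := by
      have h1 : P.biUnion id = Finset.univ := Finset.eq_univ_of_forall fun j =>
        Finset.mem_biUnion.2 ⟨S j, Finset.mem_image_of_mem _ (Finset.mem_univ j), hjS j⟩
      have h2 := Finset.card_biUnion (s := P) (t := id) hdis
      rw [h1, Finset.card_univ, hn, Finset.sum_const_nat (m := r + δ - 1)] at h2
      · exact (Nat.eq_of_mul_eq_mul_right (by omega) h2).symm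
      · intro X hX
        obtain ⟨j, rfl⟩ := hP X hX
        exact (hprop j).1
    let e : Fin m ≃ P := (P.equivFinOfCardEq hPc).symm
    refine ⟨fun i => e i, fun i j hij => hdis _ (e i).2 _ (e j).2 fun h =>
      hij (e.injective (Subtype.ext h)), fun i => ?_⟩
    obtain ⟨j, hj⟩ := hP _ (e i).2
    simp only [← hj]
    exact ⟨(hprop j).1, hS j, (hprop j).2.2⟩

end Structure

/-! ### Truncated codes -/

section Truncation

variable {F ι : Type*} [Field F] [DecidableEq ι]

/-- The projection that replaces the coordinates outside `S` by zero. -/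
def trunc (F : Type*) {ι : Type*} [Field F] [DecidableEq ι] (S : Finset ι) :
    (ι → F) →ₗ[F] (ι → F) where
  toFun x j := if j ∈ S then x j else 0
  map_add' x y := by ext j; by_cases h : j ∈ S <;> simp [h]
  map_smul' a x := by ext j; by_cases h : j ∈ S <;> simp [h]

theorem trunc_apply (S : Finset ι) (x : ι → F) (j : ι) :
    trunc F S x j = if j ∈ S then x j else 0 := rfl

/-- The words of the code `C|_S`, extended by zero outside `S`, that vanish on `D`. -/
def truncVanish (C : Submodule F (ι → F)) (S D : Finset ι) : Submodule F (ι → F) :=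
  C.map (trunc F S) ⊓ vanishOn F D

variable {C : Submodule F (ι → F)} {S D : Finset ι}

theorem eq_zero_of_mem_map_trunc {x : ι → F} (hx : x ∈ C.map (trunc F S)) {j : ι} (hj : j ∉ S) :
    x j = 0 := by
  obtain ⟨c, -, rfl⟩ := hx
  simp [trunc_apply, hj]

theorem eq_zero_of_mem_truncVanish {x : ι → F} (hx : x ∈ truncVanish C S D) {j : ι}
    (hj : j ∉ S \ D) : x j = 0 := by
  by_cases hS : j ∈ S
  · exact hx.2 j (by simpa [hS] using hj)
  · exact eq_zero_of_mem_map_trunc hx.1 hS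

theorem IsLocalSet.eq_zero_of_mem_map_trunc [DecidableEq F] {r δ : ℕ} (hS : IsLocalSet C r δ S)
    {x : ι → F} (hx : x ∈ C.map (trunc F S)) {E : Finset ι} (hE : E.card < δ)
    (h0 : ∀ j ∈ S \ E, x j = 0) : x = 0 := by
  obtain ⟨c, hc, rfl⟩ := hx
  have h := hS.vanish hE hc fun j hj => by
    simpa [trunc_apply, (Finset.mem_sdiff.1 hj).1] using h0 j hj
  ext j
  by_cases hj : j ∈ S
  · simp [trunc_apply, hj, h j hj]
  · simp [trunc_apply, hj]

variable [Fintype ι]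

theorem finrank_map_trunc_add_corank (C : Submodule F (ι → F)) (S : Finset ι) :
    finrank F (C.map (trunc F S)) + corank C S = finrank F C := by
  have h := ((trunc F S).domRestrict C).finrank_range_add_finrank_ker
  rw [LinearMap.range_domRestrict] at h
  rw [← h, corank]
  congr 1
  have hker : LinearMap.ker ((trunc F S).domRestrict C) =
      (C ⊓ vanishOn F S).comap C.subtype := by
    ext x
    simp only [LinearMap.mem_ker, funext_iff, Submodule.mem_comap, Submodule.mem_inf,
      LinearMap.domRestrict_apply, trunc_apply, mem_vanishOn, Submodule.subtype_apply]
    refine ⟨fun h => ⟨x.2, fun j hj => by simpa [hj] using h j⟩, fun h j => ?_⟩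
    split_ifs with hj
    · exact h.2 j hj
    · rfl
  rw [hker]
  exact (Submodule.comapSubtypeEquivOfLe inf_le_left).finrank_eq.symm

theorem finrank_iSup_le_sum {κ V : Type*} [Fintype κ] [AddCommGroup V] [Module F V]
    [FiniteDimensional F V] (L : κ → Submodule F V) :
    finrank F (⨆ i, L i : Submodule F V) ≤ ∑ i, finrank F (L i) := by
  classical
  rw [← Finset.sup_univ_eq_iSup]
  induction (Finset.univ : Finset κ) using Finset.induction_on with
  | empty => simp
  | insert i s hi ih =>
    rw [Finset.sup_insert, Finset.sum_insert hi]
    exact (Submodule.finrank_add_le_finrank_add_finrank _ _).trans (by omega)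

omit [Fintype ι] in
theorem map_trunc_biUnion_le {κ : Type*} [Fintype κ] (C : Submodule F (ι → F)) (T : κ → Finset ι)
    (hdis : Pairwise fun i j => Disjoint (T i) (T j)) :
    C.map (trunc F (Finset.univ.biUnion T)) ≤ ⨆ i, C.map (trunc F (T i)) := by
  rintro _ ⟨c, hc, rfl⟩
  have : trunc F (Finset.univ.biUnion T) c = ∑ i, trunc F (T i) c := by
    ext j
    rw [Finset.sum_apply]
    simp only [trunc_apply, Finset.mem_biUnion, Finset.mem_univ, true_and]
    by_cases hj : ∃ i, j ∈ T i
    · obtain ⟨i, hi⟩ := hj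
      rw [if_pos ⟨i, hi⟩, Finset.sum_eq_single i, if_pos hi]
      · intro b _ hb
        exact if_neg fun hjb => Finset.disjoint_left.1 (hdis hb) hjb hi
      · simp
    · rw [if_neg hj]
      exact (Finset.sum_eq_zero fun i _ => if_neg fun hi => hj ⟨i, hi⟩).symm
  rw [this]
  exact Submodule.sum_mem _ fun i _ => Submodule.mem_iSup_of_mem i ⟨c, hc, rfl⟩

end Truncation

/-! ### Counting subspaces that meet trivially -/

/-- A bound for partial spreads: if `dim Z / B ≤ 2 a`, then the number of subspaces of `Z` of
dimension at least `a` whose images in `Z / B` are injective and meet pairwise trivially is at most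
`(q ^ (2 a) - 1) / (q ^ a - 1) = q ^ a + 1`. -/
theorem card_le_of_partial_spread {F V κ : Type*} [Field F] [Fintype F] [AddCommGroup V]
    [Module F V] [FiniteDimensional F V] [Fintype κ] {B Z : Submodule F V} {W : κ → Submodule F V}
    {a : ℕ} (ha : 1 ≤ a) (hBZ : B ≤ Z) (hWZ : ∀ p, W p ≤ Z)
    (hdim : finrank F Z ≤ finrank F B + 2 * a) (hW : ∀ p, a ≤ finrank F (W p))
    (hWB : ∀ p, ∀ x ∈ W p, x ∈ B → x = 0)
    (hWW : ∀ p p', p ≠ p' → ∀ x ∈ W p, ∀ y ∈ W p', x - y ∈ B → x = 0) :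
    Fintype.card κ ≤ Fintype.card F ^ a + 1 := by
  classical
  have : Finite V := Module.finite_of_finite F
  have : Fintype V := Fintype.ofFinite V
  have hcard : ∀ U : Submodule F V,
      (Finset.univ.filter (· ∈ U)).card = Fintype.card F ^ finrank F U := fun U => by
    rw [← Module.card_eq_pow_finrank (K := F) (V := U), Fintype.card_subtype]
  set q := Fintype.card F
  have hq : 2 ≤ q := Fintype.one_lt_card
  let w : κ → Finset V := fun p => (Finset.univ.filter (· ∈ W p)).erase 0
  have hw : ∀ p, q ^ a - 1 ≤ (w p).card := fun p => by
    rw [Finset.card_erase_of_mem (by simp), hcard]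
    exact Nat.sub_le_sub_right (Nat.pow_le_pow_right (by omega) (hW p)) 1
  have hle : ((Finset.univ.sigma w) ×ˢ (Finset.univ.filter (· ∈ B))).card ≤
      ((Finset.univ.filter (· ∈ Z)) \ (Finset.univ.filter (· ∈ B))).card := by
    refine Finset.card_le_card_of_injOn (fun x => x.1.2 + x.2) ?_ ?_
    · rintro ⟨⟨p, x⟩, b⟩ h
      simp only [w, Finset.coe_product, Set.mem_prod, Finset.mem_coe, Finset.mem_sigma,
        Finset.mem_univ, true_and, Finset.mem_erase, Finset.mem_filter] at h
      simp only [Finset.coe_sdiff, Set.mem_sdiff, Finset.mem_coe, Finset.mem_filter,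
        Finset.mem_univ, true_and]
      refine ⟨Z.add_mem (hWZ p h.1.2) (hBZ h.2), fun hB => h.1.1 (hWB p x h.1.2 ?_)⟩
      simpa using B.sub_mem hB h.2
    · rintro ⟨⟨p, x⟩, b⟩ h ⟨⟨p', x'⟩, b'⟩ h' heq
      simp only [w, Finset.coe_product, Set.mem_prod, Finset.mem_coe, Finset.mem_sigma,
        Finset.mem_univ, true_and, Finset.mem_erase, Finset.mem_filter] at h h'
      replace heq : x + b = x' + b' := heq
      have hmem : x - x' ∈ B := by
        have : x - x' = b' - b := by
          rw [sub_eq_sub_iff_add_eq_add, heq, add_comm]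
        exact this ▸ B.sub_mem h'.2 h.2
      by_cases hp : p = p'
      · subst hp
        have hx : x = x' :=
          sub_eq_zero.1 (hWB p _ ((W p).sub_mem h.1.2 h'.1.2) hmem)
        subst hx
        rw [add_left_cancel (a := x) (b := b) (c := b') ‹_›]
      · exact absurd (hWW p p' hp x h.1.2 x' h'.1.2 hmem) h.1.1
  have hBZ' : Finset.univ.filter (· ∈ B) ⊆ Finset.univ.filter (· ∈ Z) := fun x hx => by
    simp only [Finset.mem_filter, Finset.mem_univ, true_and] at hx ⊢
    exact hBZ hx
  rw [Finset.card_product, Finset.card_sigma, Finset.card_sdiff_of_subset hBZ', hcard, hcard] at hle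
  have h1 : Fintype.card κ * (q ^ a - 1) ≤ ∑ p, (w p).card := by
    simpa using Finset.sum_le_sum fun p (_ : p ∈ Finset.univ) => hw p
  have h2 : q ^ finrank F Z ≤ q ^ finrank F B * (q ^ a * q ^ a) := by
    rw [← pow_add, ← pow_add, ← two_mul]
    exact Nat.pow_le_pow_right (by omega) hdim
  have h3 : 2 ≤ q ^ a := hq.trans (Nat.le_self_pow (by omega) q)
  have h4 : 0 < q ^ finrank F B := by positivity
  have h5 := (Nat.mul_le_mul_right (q ^ finrank F B) h1).trans hle
  obtain ⟨Q, hQ⟩ : ∃ Q, q ^ a = Q + 1 := ⟨q ^ a - 1, by omega⟩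
  rw [hQ] at h2 h5 h3 ⊢
  rw [Nat.add_sub_cancel] at h5
  have h6 : Fintype.card κ * Q * q ^ finrank F B ≤ (Q + 2) * Q * q ^ finrank F B := by
    calc _ ≤ _ := h5
      _ ≤ q ^ finrank F B * ((Q + 1) * (Q + 1)) - q ^ finrank F B := Nat.sub_le_sub_right h2 _
      _ = (Q + 2) * Q * q ^ finrank F B := by
        rw [Nat.sub_eq_iff_eq_add (Nat.le_mul_of_pos_right _ (by positivity))]; ring
  exact Nat.le_of_mul_le_mul_right (Nat.le_of_mul_le_mul_right h6 h4) (by omega)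

/-! ### The field size bounds -/

section Bounds

variable {F ι : Type*} [Field F] [DecidableEq F] [Fintype ι] [DecidableEq ι]
  {C : Submodule F (ι → F)} {r δ u M : ℕ} {T : Fin M → Finset ι}

/-- The minimum distance of the truncated code: if its nonzero words could be supported on a set `Y`
this small, then `X \ Y` would violate the Singleton-type bound. -/
theorem eq_zero_of_mem_map_trunc_of_card_le
    (hB : ∀ A : Finset ι, 0 < corank C A → A.card + corank C A ≤ u * r + (u - 1) * (δ - 1))
    {X Y : Finset ι} (hY : Y.card + (u * r + (u - 1) * (δ - 1)) ≤ X.card) {x : ι → F}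
    (hx : x ∈ C.map (trunc F X)) (h0 : ∀ j, j ∉ Y → x j = 0) : x = 0 := by
  obtain ⟨c, hc, rfl⟩ := hx
  by_contra hne
  have hc0 : c ≠ 0 := by rintro rfl; exact hne (map_zero _)
  have hv : ∀ j ∈ X \ Y, c j = 0 := fun j hj => by
    rw [Finset.mem_sdiff] at hj
    simpa [trunc_apply, hj.1] using h0 j hj.2
  have hpos : 0 < corank C (X \ Y) := by
    have : Nontrivial (C ⊓ vanishOn F (X \ Y) : Submodule F (ι → F)) :=
      Submodule.nontrivial_iff_ne_bot.2 fun h =>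
        hc0 ((Submodule.mem_bot F).1 (h ▸ (⟨hc, hv⟩ : c ∈ C ⊓ vanishOn F (X \ Y))))
    exact finrank_pos
  have h1 := hB _ hpos
  have h2 := Finset.le_card_sdiff Y X
  omega

/-- Pairwise disjoint local groups of size `r + δ - 1` and rank `r` of a code of dimension `u * r`
that meets the Singleton-type bound. -/
structure IsGroupFamily (C : Submodule F (ι → F)) (u r δ : ℕ) (T : Fin M → Finset ι) : Prop where
  finrank_eq : finrank F C = u * r
  singleton_bound : ∀ A : Finset ι, 0 < corank C A →
    A.card + corank C A ≤ u * r + (u - 1) * (δ - 1)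
  disjoint : Pairwise fun i j => Disjoint (T i) (T j)
  card_eq : ∀ i, (T i).card = r + δ - 1
  isLocalSet : ∀ i, IsLocalSet C r δ (T i)
  corank_add : ∀ i, corank C (T i) + r = u * r

namespace IsGroupFamily

omit [Fintype ι] in
theorem card_biUnion (h : IsGroupFamily C u r δ T) : (Finset.univ.biUnion T).card = M * (r + δ - 1) := by
  rw [Finset.card_biUnion fun i _ j _ hij => h.disjoint hij]
  simp [h.card_eq]

variable (h : IsGroupFamily C u r δ T)

include h

theorem finrank_map_trunc (i : Fin M) : finrank F (C.map (trunc F (T i))) = r := by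
  have h1 := finrank_map_trunc_add_corank C (T i)
  have h2 := h.corank_add i
  rw [h.finrank_eq] at h1
  omega

theorem le_finrank_truncVanish (i : Fin M) (D : Finset ι) :
    r ≤ finrank F (truncVanish C (T i) D) + D.card := by
  have := finrank_le_finrank_inf_vanishOn_add (C.map (trunc F (T i))) D
  rwa [h.finrank_map_trunc] at this

theorem finrank_iSup_le : finrank F (⨆ i, C.map (trunc F (T i)) : Submodule F (ι → F)) ≤ M * r :=
  (finrank_iSup_le_sum _).trans (by simp [h.finrank_map_trunc])

theorem finrank_map_trunc_biUnion (hδ : 1 ≤ δ)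
    (hM : u ≤ M) :
    finrank F (C.map (trunc F (Finset.univ.biUnion T))) = u * r := by
  have h1 := finrank_map_trunc_add_corank C (Finset.univ.biUnion T)
  have h2 : corank C (Finset.univ.biUnion T) = 0 := by
    by_contra hne
    have h3 := h.singleton_bound _ (Nat.pos_of_ne_zero hne)
    have h4 : u * r + (u - 1) * (δ - 1) ≤ (Finset.univ.biUnion T).card := by
      rw [h.card_biUnion, Nat.add_sub_assoc hδ, mul_add]
      exact Nat.add_le_add (Nat.mul_le_mul_right _ hM) (Nat.mul_le_mul_right _ (by omega))
    omega
  rw [h2, h.finrank_eq] at h1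
  exact h1

/-- Words of different groups vanish if they agree modulo the code, as long as their supports are
too small for a nonzero codeword. -/
theorem eq_zero_of_sub_mem {i j : Fin M} (hij : i ≠ j) {D E : Finset ι} {x y : ι → F}
    (hx : x ∈ truncVanish C (T i) D) (hy : y ∈ truncVanish C (T j) E)
    (hcard : (T i \ D).card + (T j \ E).card + (u * r + (u - 1) * (δ - 1)) ≤ M * (r + δ - 1))
    (hxy : x - y ∈ C.map (trunc F (Finset.univ.biUnion T))) : x = 0 := by
  have h0 := eq_zero_of_mem_map_trunc_of_card_le h.singleton_bound
    (Y := (T i \ D) ∪ (T j \ E)) (by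
      have := Finset.card_union_le (T i \ D) (T j \ E)
      rw [h.card_biUnion]; omega) hxy fun l hl => by
        rw [Finset.mem_union, not_or] at hl
        simp [eq_zero_of_mem_truncVanish hx hl.1, eq_zero_of_mem_truncVanish hy hl.2]
  ext l
  by_cases hl : l ∈ T i
  · rw [sub_eq_zero.1 h0]
    exact eq_zero_of_mem_map_trunc hy.1 fun hlj => Finset.disjoint_left.1 (h.disjoint hij) hl hlj
  · exact eq_zero_of_mem_map_trunc hx.1 hl

end IsGroupFamily

/-- Each of the `u + 1` groups is cut by `f` disjoint sets of size `a = r / 2`, and the words of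
the group that vanish on one of these sets form a subspace of dimension at least `a`. -/
theorem IsGroupFamily.mul_le_of_even [Fintype F] {T : Fin (u + 1) → Finset ι} {a f : ℕ}
    (h : IsGroupFamily C u r δ T) (hr : r = 2 * a) (ha : 1 ≤ a) (hδ : 1 ≤ δ) (hu : 1 ≤ u)
    (hf : f * a ≤ r + δ - 1) : (u + 1) * f ≤ Fintype.card F ^ a + 1 := by
  obtain ⟨e, rfl⟩ : ∃ e, δ = e + 1 := ⟨δ - 1, by omega⟩
  obtain ⟨v, rfl⟩ : ∃ v, u = v + 1 := ⟨u - 1, by omega⟩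
  choose D hDT hDc hDd using fun i => exists_pairwise_disjoint_subsets (T i) (f := f) (s := a)
    (by rw [h.card_eq]; exact hf)
  have hsd : ∀ i l, (T i \ D i l).card = a + e := fun i l => by
    rw [Finset.card_sdiff_of_subset (hDT i l), h.card_eq, hDc]; omega
  have hexp : (v + 1 + 1) * (r + (e + 1) - 1) = (v + 1) * r + v * e + r + 2 * e := by
    rw [show r + (e + 1) - 1 = r + e by omega]; ring
  set X := Finset.univ.biUnion T
  have hwt : ∀ i j l l', (T i \ D i l).card + (T j \ D j l').card +
      ((v + 1) * r + (v + 1 - 1) * (e + 1 - 1)) ≤ (v + 1 + 1) * (r + (e + 1) - 1) := by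
    intro i j l l'
    rw [hsd, hsd, hexp, Nat.add_sub_cancel, Nat.add_sub_cancel]
    omega
  have hin : ∀ i, ∀ x ∈ C.map (trunc F (T i)), x ∈ C.map (trunc F X) → x = 0 := by
    intro i x hx hxX
    refine eq_zero_of_mem_map_trunc_of_card_le h.singleton_bound (Y := T i) ?_ hxX
      fun j hj => eq_zero_of_mem_map_trunc hx hj
    rw [h.card_biUnion, h.card_eq, hexp, Nat.add_sub_cancel, Nat.add_sub_cancel]
    omega
  have key := card_le_of_partial_spread (κ := Fin (v + 1 + 1) × Fin f) (a := a)
    (B := C.map (trunc F X)) (Z := ⨆ i, C.map (trunc F (T i)))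
    (W := fun p => truncVanish C (T p.1) (D p.1 p.2)) ha
    (map_trunc_biUnion_le C T h.disjoint)
    (fun p => inf_le_left.trans (le_iSup (fun i => C.map (trunc F (T i))) p.1))
    (by
      have h1 := h.finrank_iSup_le
      rw [h.finrank_map_trunc_biUnion hδ (by omega)]
      rw [add_mul (v + 1) 1 r] at h1
      omega)
    (fun p => by
      have := h.le_finrank_truncVanish p.1 (D p.1 p.2)
      rw [hDc] at this
      omega)
    (fun p x hx hxX => hin p.1 x hx.1 hxX)
    (by
      rintro ⟨i, l⟩ ⟨j, l'⟩ hp x hx y hy hxy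
      by_cases hij : i = j
      · subst hij
        have hll : l ≠ l' := fun hl => hp (by rw [hl])
        have hxy0 := hin i _ ((C.map (trunc F (T i))).sub_mem hx.1 hy.1) hxy
        rw [sub_eq_zero] at hxy0
        have hU : D i l ∪ D i l' ⊆ T i := Finset.union_subset (hDT i l) (hDT i l')
        -- a common word vanishes on the `r` coordinates of `D i l ∪ D i l'`
        refine (h.isLocalSet i).eq_zero_of_mem_map_trunc hx.1
          (E := T i \ (D i l ∪ D i l')) ?_ ?_
        · rw [Finset.card_sdiff_of_subset hU, h.card_eq,
            Finset.card_union_of_disjoint (hDd i hll), hDc, hDc]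
          omega
        · intro s hs
          rw [Finset.sdiff_sdiff_eq_self hU, Finset.mem_union] at hs
          exact hs.elim (fun hs => hx.2 s hs) fun hs => hxy0 ▸ hy.2 s hs
      · exact h.eq_zero_of_sub_mem hij hx hy (hwt i j l l') hxy)
  simpa using key

/-- For odd `r`, a subspace of dimension `r - 1` from one group is factored out first, so that the
remaining `u + 1` groups give subspaces of dimension `(r + 1) / 2` of a space of dimension
`r + 1`. -/
theorem IsGroupFamily.le_of_odd [Fintype F] {T : Fin (u + 2) → Finset ι} {a : ℕ}
    (h : IsGroupFamily C u r δ T) (hr : r + 1 = 2 * a) (ha : 1 ≤ a) (hδ : 1 ≤ δ) (hu : 1 ≤ u) :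
    u ≤ Fintype.card F ^ a := by
  obtain ⟨e, rfl⟩ : ∃ e, δ = e + 1 := ⟨δ - 1, by omega⟩
  obtain ⟨v, rfl⟩ : ∃ v, u = v + 1 := ⟨u - 1, by omega⟩
  choose D hDT hDc using fun i => Finset.exists_subset_card_eq (s := T i) (n := a - 1)
    (by rw [h.card_eq]; omega)
  obtain ⟨E, hET, hEc⟩ := Finset.exists_subset_card_eq (s := T 0) (n := 1)
    (by rw [h.card_eq]; omega)
  have hsd : ∀ i, (T i \ D i).card = a + e := fun i => by
    rw [Finset.card_sdiff_of_subset (hDT i), h.card_eq, hDc]; omega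
  have hsE : (T 0 \ E).card + 1 = r + e := by
    rw [Finset.card_sdiff_of_subset hET, h.card_eq, hEc]; omega
  have hexp : (v + 1 + 2) * (r + (e + 1) - 1) = (v + 1) * r + v * e + 2 * r + 3 * e := by
    rw [show r + (e + 1) - 1 = r + e by omega]; ring
  set X := Finset.univ.biUnion T
  set Y := truncVanish C (T 0) E
  have hYX : C.map (trunc F X) ⊓ Y = ⊥ := by
    rw [eq_bot_iff]
    rintro x ⟨hx, hxY⟩
    refine eq_zero_of_mem_map_trunc_of_card_le h.singleton_bound (Y := T 0 \ E) ?_ hx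
      fun j hj => eq_zero_of_mem_truncVanish hxY hj
    rw [h.card_biUnion, hexp, Nat.add_sub_cancel, Nat.add_sub_cancel]
    omega
  have hmain : ∀ i i' : Fin (v + 1 + 2), i ≠ 0 → i' ≠ 0 → i ≠ i' → ∀ x ∈ truncVanish C (T i) (D i),
      ∀ y ∈ truncVanish C (T i') (D i'), x - y ∈ C.map (trunc F X) ⊔ Y → x = 0 := by
    intro i i' hi hi' hii x hx y hy hxy
    obtain ⟨b, hb, z, hz, hbz⟩ := Submodule.mem_sup.1 hxy
    have hbeq : b = x - y - z := by rw [← hbz]; simp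
    have h0 : b = 0 := by
      refine eq_zero_of_mem_map_trunc_of_card_le h.singleton_bound
        (Y := (T i \ D i) ∪ (T i' \ D i') ∪ (T 0 \ E)) ?_ hb ?_
      · have h1 := Finset.card_union_le (T i \ D i) (T i' \ D i')
        have h2 := Finset.card_union_le ((T i \ D i) ∪ (T i' \ D i')) (T 0 \ E)
        rw [hsd, hsd] at h1
        rw [h.card_biUnion, hexp, Nat.add_sub_cancel, Nat.add_sub_cancel]
        omega
      · intro j hj
        simp only [Finset.mem_union, not_or] at hj
        simp [hbeq, eq_zero_of_mem_truncVanish hx hj.1.1, eq_zero_of_mem_truncVanish hy hj.1.2,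
          eq_zero_of_mem_truncVanish hz hj.2]
    rw [h0, zero_add] at hbz
    ext j
    by_cases hj : j ∈ T i
    · have hj' : y j = 0 := eq_zero_of_mem_map_trunc hy.1
        (Finset.disjoint_left.1 (h.disjoint hii) hj)
      have hj0 : z j = 0 := eq_zero_of_mem_map_trunc hz.1
        (Finset.disjoint_left.1 (h.disjoint hi) hj)
      have := congrFun hbz j
      rw [Pi.sub_apply, hj', hj0, sub_zero] at this
      exact this.symm
    · exact eq_zero_of_mem_map_trunc hx.1 hj
  have key := card_le_of_partial_spread (κ := Fin (v + 1 + 1)) (a := a)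
    (B := C.map (trunc F X) ⊔ Y) (Z := ⨆ i, C.map (trunc F (T i)))
    (W := fun p => truncVanish C (T p.succ) (D p.succ)) ha
    (sup_le (map_trunc_biUnion_le C T h.disjoint)
      (inf_le_left.trans (le_iSup (fun i => C.map (trunc F (T i))) 0)))
    (fun p => inf_le_left.trans (le_iSup (fun i => C.map (trunc F (T i))) p.succ))
    (by
      have h1 := h.finrank_iSup_le
      have h2 := Submodule.finrank_sup_add_finrank_inf_eq (C.map (trunc F X)) Y
      rw [hYX, finrank_bot, h.finrank_map_trunc_biUnion hδ (by omega)] at h2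
      have h3 : r ≤ finrank F Y + E.card := h.le_finrank_truncVanish 0 E
      rw [hEc] at h3
      rw [add_mul (v + 1) 2 r] at h1
      omega)
    (fun p => by
      have := h.le_finrank_truncVanish p.succ (D p.succ)
      rw [hDc] at this
      omega)
    (fun p x hx hxX => by
      -- a second group serves only to supply the word `0`
      obtain ⟨p', hp'⟩ := exists_ne p
      exact hmain p.succ p'.succ (Fin.succ_ne_zero _) (Fin.succ_ne_zero _)
        (fun h => hp' (Fin.succ_injective _ h).symm) x hx 0 (Submodule.zero_mem _) (by simpa))
    (fun p p' hp x hx y hy hxy => hmain p.succ p'.succ (Fin.succ_ne_zero _) (Fin.succ_ne_zero _)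
      (fun h => hp (Fin.succ_injective _ h)) x hx y hy hxy)
  rw [Fintype.card_fin] at key
  omega

end Bounds

/-! ### Optimal locally repairable codes -/

section OptimalLRC

variable {F : Type*} [Field F] [DecidableEq F]

theorem le_hammingNorm_of_le_minDist {ι : Type*} [Fintype ι] {C : Submodule F (ι → F)} {d : ℕ∞}
    (h : d ≤ minDist C) {c : ι → F} (hc : c ∈ C) (h0 : c ≠ 0) : d ≤ hammingNorm c := by
  simp only [minDist, le_iInf_iff] at h
  simpa using h c hc 0 C.zero_mem h0

theorem one_le_minDist {ι : Type*} [Fintype ι] (C : Submodule F (ι → F)) : 1 ≤ minDist C := by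
  simp only [minDist, le_iInf_iff]
  intro x _ y _ hxy
  exact_mod_cast hammingDist_pos.2 hxy

theorem IsRepairSet.isLocalSet {n r δ : ℕ} {C : Submodule F (Fin n → F)} {j : Fin n}
    {S : Finset (Fin n)} (h : IsRepairSet C r δ j S) : IsLocalSet C r δ S := by
  refine ⟨h.2.1, fun c hc hne => ?_⟩
  obtain ⟨i, hi, hci⟩ := hne
  have h1 := le_hammingNorm_of_le_minDist h.2.2
    (c := LinearMap.funLeft F F (fun j : S => (j : Fin n)) c) ⟨c, hc, rfl⟩
    (fun h0 => hci (congrFun h0 ⟨i, hi⟩))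
  rw [Nat.cast_le] at h1
  refine h1.trans (Finset.card_le_card_of_injOn Subtype.val (fun x hx => ?_)
    Subtype.val_injective.injOn)
  have hx' : c x ≠ 0 := (Finset.mem_filter.1 (Finset.mem_coe.1 hx)).2
  simpa using hx'

theorem exists_isGroupFamily {n d r δ m u : ℕ} {C : Submodule F (Fin n → F)}
    (hr : 1 ≤ r) (hδ : 1 ≤ δ) (hu : 2 ≤ u) (hn : n = m * (r + δ - 1))
    (hopt : IsOptimalLRC C (u * r) d r δ) (hloc : HasAllSymbolLocality C r δ) :
    ∃ T : Fin m → Finset (Fin n), IsGroupFamily C u r δ T := by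
  obtain ⟨⟨hk, hd⟩, -, hdn⟩ := hopt
  have hceil : ⌈((u * r : ℕ) : ℝ) / r⌉ = (u : ℤ) := by
    have : (r : ℝ) ≠ 0 := by positivity
    rw [Nat.cast_mul, mul_div_cancel_right₀ _ this, Int.ceil_natCast]
  have hd1 : 1 ≤ d := by exact_mod_cast hd ▸ one_le_minDist C
  have hdn' : d + (u * r + (u - 1) * (δ - 1)) = n + 1 := by
    rw [hceil] at hdn
    zify [hδ, (by omega : 1 ≤ u)]
    push_cast at hdn
    linarith
  have hB : ∀ A : Finset (Fin n), 0 < corank C A →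
      A.card + corank C A ≤ u * r + (u - 1) * (δ - 1) := fun A hA => by
    have := card_add_corank_le hd1 (fun c hc h0 => by
      exact_mod_cast le_hammingNorm_of_le_minDist hd.ge hc h0) hA
    rw [Fintype.card_fin] at this
    omega
  obtain ⟨T, hT, h⟩ := exists_local_groups hk hr hδ hu hB
    (fun j => (hloc j).imp fun S hS => ⟨hS.1, hS.isLocalSet⟩) (by rw [Fintype.card_fin, hn])
  exact ⟨T, hk, hB, hT, fun i => (h i).1, fun i => (h i).2.1, fun i => (h i).2.2⟩

theorem IsGroupFamily.castLE {ι : Type*} [DecidableEq ι] {C : Submodule F (ι → F)}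
    {u r δ m M : ℕ} {T : Fin m → Finset ι} (h : IsGroupFamily C u r δ T) (hM : M ≤ m) :
    IsGroupFamily C u r δ (fun i => T (Fin.castLE hM i)) where
  finrank_eq := h.finrank_eq
  singleton_bound := h.singleton_bound
  disjoint _ _ hij := h.disjoint fun e => hij (Fin.castLE_injective hM e)
  card_eq _ := h.card_eq _
  isLocalSet _ := h.isLocalSet _
  corank_add _ := h.corank_add _

omit [DecidableEq F] in
theorem leastPrimePower_rpow_le_card [Fintype F] {x : ℝ} {a : ℕ} {s : ℝ} (ha : 1 ≤ a)
    (hx : 0 ≤ x) (hs : s = (a : ℝ)⁻¹) (h : x ≤ (Fintype.card F : ℝ) ^ a) :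
    leastPrimePower (x ^ s) ≤ Fintype.card F := by
  refine (leastPrimePower_isLeast _).2 ⟨Fintype.isPrimePow_card_of_field, ?_⟩
  rw [hs]
  calc x ^ (a : ℝ)⁻¹ ≤ ((Fintype.card F : ℝ) ^ a) ^ (a : ℝ)⁻¹ :=
        Real.rpow_le_rpow hx h (by positivity)
    _ = Fintype.card F := Real.pow_rpow_inv_natCast (by positivity) (by omega)

end OptimalLRC

theorem mainTheorem1 {F : Type*} [Field F] [Fintype F] [DecidableEq F]
    (n k d r δ m u : ℕ) (C : Submodule F (Fin n → F))
    (hr : 1 ≤ r) (hδ : 1 ≤ δ)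
    (hopt : IsOptimalLRC C k d r δ) (hloc : HasAllSymbolLocality C r δ)
    (hn : n = m * (r + δ - 1)) (hk : k = u * r) (hu : 2 ≤ u) :
    (Even r → u + 1 ≤ m →
      Fintype.card F ≥ leastPrimePower
        ((((k : ℝ) / r + 1) * (⌊(2 * (r : ℝ) + 2 * δ - 2) / r⌋ : ℝ) - 1) ^ ((2 : ℝ) / r))) ∧
    (Odd r → u + 2 ≤ m →
      Fintype.card F ≥ leastPrimePower (((k : ℝ) / r) ^ ((2 : ℝ) / (r + 1)))) := by
  subst hk
  obtain ⟨T, hT⟩ := exists_isGroupFamily hr hδ hu hn hopt hloc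
  have hr0 : (r : ℝ) ≠ 0 := by positivity
  have hkr : ((u * r : ℕ) : ℝ) / r = u := by rw [Nat.cast_mul, mul_div_cancel_right₀ _ hr0]
  rw [hkr]
  constructor
  · rintro ⟨a, ha⟩ hm
    have ha1 : 1 ≤ a := by omega
    have hra : (r : ℝ) = 2 * a := by rw [ha]; push_cast; ring
    have ha0 : (a : ℝ) ≠ 0 := by positivity
    obtain ⟨f, hf⟩ : ∃ f : ℕ, f = (r + δ - 1) / a := ⟨_, rfl⟩
    have hfloor : (⌊(2 * (r : ℝ) + 2 * δ - 2) / r⌋ : ℝ) = f := by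
      have h1 : (2 * (r : ℝ) + 2 * δ - 2) / r = ((r + δ - 1 : ℕ) : ℝ) / a := by
        rw [Nat.cast_sub (by omega)]
        push_cast
        rw [hra]
        field_simp
      rw [h1, Int.floor_div_natCast, Int.floor_natCast, hf]
      norm_cast
    have hf1 : 1 ≤ f := by
      rw [hf]; exact (Nat.one_le_div_iff ha1).2 (by omega)
    have key := (hT.castLE hm).mul_le_of_even (f := f) (by omega) ha1 hδ (by omega)
      (by rw [hf]; exact Nat.div_mul_le_self _ _)
    have key' : ((u : ℝ) + 1) * f ≤ (Fintype.card F : ℝ) ^ a + 1 := by exact_mod_cast key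
    rw [hfloor]
    refine leastPrimePower_rpow_le_card ha1 ?_ ?_ (by linarith)
    · have : (1 : ℝ) ≤ f := by exact_mod_cast hf1
      nlinarith [(Nat.cast_nonneg u : (0 : ℝ) ≤ u)]
    · rw [hra]; field_simp
  · rintro ⟨b, hb⟩ hm
    have key := (hT.castLE hm).le_of_odd (a := b + 1) (by omega) (by omega) hδ (by omega)
    refine leastPrimePower_rpow_le_card (a := b + 1) (by omega) (Nat.cast_nonneg u) ?_
      (by exact_mod_cast key)
    rw [hb]
    push_cast
    rw [show (2 : ℝ) * b + 1 + 1 = 2 * (b + 1) by ring]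
    field_simp
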